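/- Let $c,r$ be real numbers with $0<c<c+r<1$, so that the circle with centre $c$ and radius $r$ lies inside the unit circle. Put $I=\frac{1+c^2-r^2}{2c}$ (so $I>1$), let $\Phi(\phi,I)=\int_0^{\phi}\frac{dt}{\sqrt{I-\cos t}}$, let $\varphi\in(0,\pi)$ be the angle with $\cos\varphi=\frac{2r^2}{(1-c)^2}-1$ (the chord of the unit circle from $1$ to $e^{i\varphi}$ is then tangent to the inner circle), and let $$\theta=\frac{\Phi(\varphi,I)}{2\,\Phi(\pi,I)}.$$ Define $\gamma_1=1$, $\gamma_2=\frac{2r}{1-c^2}$ and $$\gamma_{k+1}=\frac{|1-\gamma_k^2|}{(1-c^2\gamma_k^2)\,\gamma_{k-1}},\qquad k=2,3,\ldots,$$ where, if $\gamma_{k-1}=0$ for some $k$ (which can happen only if $\theta$ is rational), the quotient, which is then $0/0$, is read as $0$. For real $x$ let $\|x\|$ be the distance from $x$ to the nearest integer. A fraction $p/q$ ($p\in\mathbb Z$, $q$ a positive integer) is called a best approximation of $\theta$ if $\|q\theta\|=|q\theta-p|<\|j\theta\|$ for all positive integers $j<q$. Then: 1. The numbers $w_k=c\gamma_k^2$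 satisfy $(c\,w_kw_{k+1}-w_k-w_{k+1}+c)^2-4r^2w_kw_{k+1}=0$ for all $k\ge1$. 2. A positive integer $q$ satisfies $\gamma_k>\gamma_q$ for all $1\le k<q$ if and only if $q$ is the denominator of a best approximation of $\theta$. 3. If $\theta$ is irrational, then all $\gamma_k$ ($k\ge1$) are positive, the integers $q$ in part 2 form an infinite increasing sequence $q_1<q_2<\cdots$, and $\gamma_{q_1}>\gamma_{q_2}>\cdots\to0$. -/

import Mathlib

open Filter Topology

noncomputable section

/-- The incomplete integral `Φ(φ, I) = ∫₀^φ dt / √(I - cos t)`. -/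
def ellipticPhi (φ I : ℝ) : ℝ := ∫ t in (0 : ℝ)..φ, 1 / Real.sqrt (I - Real.cos t)

/-- The real abscissa `I` of the common points of the unit circle and of the circle with
centre `c` and radius `r`. -/
def pencilAbscissa (c r : ℝ) : ℝ := (1 + c ^ 2 - r ^ 2) / (2 * c)

/-- The polynomial `p(z, w)`: for `z ≠ w` on the unit circle, the chord `[z, w]` is tangent to the
circle with centre `c` and radius `r` iff `p(z, w) = 0`. Here it is used at real arguments. -/
def tangencyPoly (c r z w : ℝ) : ℝ := (c * w * z - w - z + c) ^ 2 - 4 * r ^ 2 * w * z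

/-- The sequence `γ₁ = 1`, `γ₂ = 2r / (1 - c²)`,
`γ_{k+1} = |1 - γ_k²| / ((1 - c² γ_k²) γ_{k-1})` for `k ≥ 2`.
The value at index `0` only fills the unused place. If some `γ_k` vanishes, the undefined quotient
`0 / 0` that occurs two steps later is read as `0`. -/
def gammaSeq (c r : ℝ) : ℕ → ℝ
  | 0 => 0
  | 1 => 1
  | 2 => 2 * r / (1 - c ^ 2)
  | k + 3 => |1 - gammaSeq c r (k + 2) ^ 2| /
      ((1 - c ^ 2 * gammaSeq c r (k + 2) ^ 2) * gammaSeq c r (k + 1))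

/-- `q ≥ 1` is a record-minimum index of the sequence `u₁, u₂, …`: `u_q` is smaller than all
earlier terms. -/
def IsRecordMin (u : ℕ → ℝ) (q : ℕ) : Prop :=
  1 ≤ q ∧ ∀ k : ℕ, 1 ≤ k → k < q → u q < u k

/-- The distance from `x` to the nearest integer. -/
def distNearestInt (x : ℝ) : ℝ := min (Int.fract x) (1 - Int.fract x)

/-- The fraction `p / q` with `q > 0` is a best approximation of `α`:
`‖qα‖ = |qα - p| < ‖jα‖` for all positive integers `j < q`. -/
def IsBestApprox (α : ℝ) (p : ℤ) (q : ℕ) : Prop :=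
  0 < q ∧ distNearestInt (q * α) = |q * α - p| ∧
    ∀ j : ℕ, 0 < j → j < q → |q * α - p| < distNearestInt (j * α)

end

/-! The recurrence is the addition theorem for the Jacobi function sn in disguise. Write `I = (1 +
k²)/(2k)` with `0 < k < 1`. A rescaled sn of modulus `k`, here `pencilSn k`, is an explicit function
of the inverse of `Φ(·, I)`, and at `v = Φ(φ, I)` it satisfies `k sn² v = c` and `cn v dn v = r`
(`pencilSn_tangent`). Put `g n = |sn(n v)| / sn v`. The formula for `sn(u+v) sn(u-v)`
(`pencilSn_add_mul_sub`) is the recurrence for `g`, and the addition formula yields the tangency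
equation (`tangencyPoly_pencilSn_add`).

With `P = Φ(π, I)`, |sn| is even, has period `2P` and increases on `[0, P]`. Since `v = 2Pθ`, `g n`
is a strictly increasing function of the distance from `nθ` to the integers (`abs_pencilSn_lt_iff`),
so records of `g` are best approximations. Dirichlet's theorem gives the limit. `gammaSeq` equals
`g` up to the first zero, after which neither sequence has a record. -/

/-! ### The elliptic integral and its inverse -/

theorem ellipticPhi_integrand_continuous {I : ℝ} (hI : 1 < I) :
    Continuous fun t : ℝ => 1 / Real.sqrt (I - Real.cos t) := by
  refine continuous_const.div (by fun_prop) fun t => ?_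
  have := Real.cos_le_one t
  exact (Real.sqrt_pos.2 (by linarith)).ne'

theorem ellipticPhi_hasDerivAt {I : ℝ} (hI : 1 < I) (t : ℝ) :
    HasDerivAt (fun t => ellipticPhi t I) (1 / Real.sqrt (I - Real.cos t)) t :=
  (ellipticPhi_integrand_continuous hI).integral_hasStrictDerivAt 0 t |>.hasDerivAt

theorem ellipticPhi_zero (I : ℝ) : ellipticPhi 0 I = 0 := by simp [ellipticPhi]

theorem ellipticPhi_neg (t I : ℝ) : ellipticPhi (-t) I = -ellipticPhi t I := by
  have h := intervalIntegral.integral_comp_neg (a := 0) (b := t)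
    (fun t : ℝ => 1 / Real.sqrt (I - Real.cos t))
  simp only [Real.cos_neg, neg_zero] at h
  rw [ellipticPhi, ellipticPhi, h, intervalIntegral.integral_symm]

theorem ellipticPhi_add_two_pi {I : ℝ} (hI : 1 < I) (t : ℝ) :
    ellipticPhi (t + 2 * Real.pi) I = ellipticPhi t I + 2 * ellipticPhi Real.pi I := by
  have hc := ellipticPhi_integrand_continuous hI
  have hper : Function.Periodic (fun t : ℝ => 1 / Real.sqrt (I - Real.cos t)) (2 * Real.pi) :=
    fun t => by simp [Real.cos_add_two_pi]
  have h1 := intervalIntegral.integral_add_adjacent_intervals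
    (hc.intervalIntegrable (μ := MeasureTheory.volume) 0 t)
    (hc.intervalIntegrable t (t + 2 * Real.pi))
  have h2 := hper.intervalIntegral_add_eq t (-Real.pi)
  have h3 := intervalIntegral.integral_add_adjacent_intervals
    (hc.intervalIntegrable (μ := MeasureTheory.volume) (-Real.pi) 0)
    (hc.intervalIntegrable 0 Real.pi)
  have h4 := ellipticPhi_neg Real.pi I
  rw [ellipticPhi, intervalIntegral.integral_symm] at h4
  rw [show -Real.pi + 2 * Real.pi = Real.pi by ring] at h2
  simp only [ellipticPhi] at h4 ⊢
  linarith

theorem ellipticPhi_strictMono {I : ℝ} (hI : 1 < I) : StrictMono fun t => ellipticPhi t I := by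
  refine strictMono_of_deriv_pos fun t => ?_
  rw [(ellipticPhi_hasDerivAt hI t).deriv]
  have := Real.cos_le_one t
  exact one_div_pos.2 (Real.sqrt_pos.2 (by linarith))

theorem ellipticPhi_surjective {I : ℝ} (hI : 1 < I) :
    Function.Surjective fun t => ellipticPhi t I := by
  have hc := ellipticPhi_integrand_continuous hI
  have hper : Function.Periodic (fun t : ℝ => 1 / Real.sqrt (I - Real.cos t)) (2 * Real.pi) :=
    fun t => by simp [Real.cos_add_two_pi]
  have hpos : ∀ t : ℝ, 0 < 1 / Real.sqrt (I - Real.cos t) := fun t => by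
    have := Real.cos_le_one t
    exact one_div_pos.2 (Real.sqrt_pos.2 (by linarith))
  have hcont : Continuous fun t => ellipticPhi t I :=
    continuous_iff_continuousAt.2 fun t => (ellipticPhi_hasDerivAt hI t).continuousAt
  exact hcont.surjective
    (hper.tendsto_atTop_intervalIntegral_of_pos' (hc.intervalIntegrable _ _) hpos
      Real.two_pi_pos)
    (hper.tendsto_atBot_intervalIntegral_of_pos' (hc.intervalIntegrable _ _) hpos
      Real.two_pi_pos)

/-- The amplitude: the inverse function of `Φ(·, I)`. -/
noncomputable def ellipticAmp (I : ℝ) : ℝ → ℝ := Function.invFun fun t => ellipticPhi t I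

theorem ellipticPhi_ellipticAmp {I : ℝ} (hI : 1 < I) (u : ℝ) :
    ellipticPhi (ellipticAmp I u) I = u :=
  Function.rightInverse_invFun (ellipticPhi_surjective hI) u

theorem ellipticAmp_ellipticPhi {I : ℝ} (hI : 1 < I) (t : ℝ) :
    ellipticAmp I (ellipticPhi t I) = t :=
  Function.leftInverse_invFun (ellipticPhi_strictMono hI).injective t

theorem ellipticAmp_strictMono {I : ℝ} (hI : 1 < I) : StrictMono (ellipticAmp I) := by
  intro u v huv
  rw [← (ellipticPhi_strictMono hI).lt_iff_lt]
  simpa [ellipticPhi_ellipticAmp hI] using huv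

theorem ellipticAmp_hasDerivAt {I : ℝ} (hI : 1 < I) (u : ℝ) :
    HasDerivAt (ellipticAmp I) (Real.sqrt (I - Real.cos (ellipticAmp I u))) u := by
  have hcont : Continuous (ellipticAmp I) :=
    (ellipticAmp_strictMono hI).monotone.continuous_of_surjective
      fun t => ⟨_, ellipticAmp_ellipticPhi hI t⟩
  have hpos : 0 < Real.sqrt (I - Real.cos (ellipticAmp I u)) := by
    have := Real.cos_le_one (ellipticAmp I u)
    exact Real.sqrt_pos.2 (by linarith)
  have h := (ellipticPhi_hasDerivAt hI (ellipticAmp I u)).of_local_left_inverse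
    hcont.continuousAt (one_div_pos.2 hpos).ne'
    (Eventually.of_forall fun v => ellipticPhi_ellipticAmp hI v)
  simpa using h

theorem ellipticAmp_zero {I : ℝ} (hI : 1 < I) : ellipticAmp I 0 = 0 := by
  simpa [ellipticPhi_zero] using ellipticAmp_ellipticPhi hI 0

theorem ellipticAmp_neg {I : ℝ} (hI : 1 < I) (u : ℝ) : ellipticAmp I (-u) = -ellipticAmp I u := by
  apply (ellipticPhi_strictMono hI).injective
  simp only [ellipticPhi_neg, ellipticPhi_ellipticAmp hI]

theorem ellipticAmp_add_period {I : ℝ} (hI : 1 < I) (u : ℝ) :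
    ellipticAmp I (u + 2 * ellipticPhi Real.pi I) = ellipticAmp I u + 2 * Real.pi := by
  apply (ellipticPhi_strictMono hI).injective
  simp only [ellipticPhi_add_two_pi hI, ellipticPhi_ellipticAmp hI]

/-! ### The functions sn and cn·dn -/

/-- The sine amplitude of modulus `k`, with argument normalized so that it is a function of
`Φ(·, I)` for `2 k I = 1 + k²`. -/
noncomputable def pencilSn (k u : ℝ) : ℝ :=
  2 * Real.sin (ellipticAmp ((1 + k ^ 2) / (2 * k)) u / 2) /
    ((1 - k) + Real.sqrt (1 + k ^ 2 - 2 * k * Real.cos (ellipticAmp ((1 + k ^ 2) / (2 * k)) u)))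

/-- The product `cn · dn` that belongs to `pencilSn`. -/
noncomputable def pencilCnDn (k u : ℝ) : ℝ :=
  2 * (1 - k) * Real.cos (ellipticAmp ((1 + k ^ 2) / (2 * k)) u / 2) /
    ((1 - k) + Real.sqrt (1 + k ^ 2 - 2 * k * Real.cos (ellipticAmp ((1 + k ^ 2) / (2 * k)) u)))

theorem one_lt_of_modulus {k : ℝ} (h0 : 0 < k) (h1 : k < 1) : 1 < (1 + k ^ 2) / (2 * k) := by
  rw [lt_div_iff₀ (by positivity)]
  nlinarith [sq_pos_of_pos (sub_pos.2 h1)]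

theorem pencil_radicand_pos {k : ℝ} (h0 : 0 < k) (h1 : k < 1) (t : ℝ) :
    0 < 1 + k ^ 2 - 2 * k * Real.cos t := by
  nlinarith [sq_pos_of_pos (sub_pos.2 h1), Real.cos_le_one t]

theorem pencil_radicand_eq (k t : ℝ) :
    1 + k ^ 2 - 2 * k * Real.cos t = (1 - k) ^ 2 + 4 * k * Real.sin (t / 2) ^ 2 := by
  have h := Real.cos_sq (t / 2)
  have h' := Real.sin_sq_add_cos_sq (t / 2)
  rw [show 2 * (t / 2) = t by ring] at h
  linear_combination 4 * k * h - 4 * k * h'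

/-- With `ρ` the square root, `sin² (t/2)` is a polynomial in `ρ`, so this is a rational identity in
`ρ`. -/
theorem pencilCnDn_sq {k : ℝ} (h0 : 0 < k) (h1 : k < 1) (u : ℝ) :
    pencilCnDn k u ^ 2 = (1 - pencilSn k u ^ 2) * (1 - k ^ 2 * pencilSn k u ^ 2) := by
  unfold pencilCnDn pencilSn
  generalize ellipticAmp ((1 + k ^ 2) / (2 * k)) u = t
  have hρ := Real.sq_sqrt (pencil_radicand_pos h0 h1 t).le
  have hp := Real.sqrt_pos.2 (pencil_radicand_pos h0 h1 t)
  rw [pencil_radicand_eq] at *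
  generalize Real.sqrt _ = ρ at *
  have hc : Real.cos (t / 2) ^ 2 = 1 - Real.sin (t / 2) ^ 2 := by
    linarith [Real.sin_sq_add_cos_sq (t / 2)]
  have hs : Real.sin (t / 2) ^ 2 = (ρ ^ 2 - (1 - k) ^ 2) / (4 * k) := by
    field_simp; linarith
  have hd : (1 - k) + ρ ≠ 0 := (add_pos (sub_pos.2 h1) hp).ne'
  simp only [div_pow, mul_pow, hc, hs]
  field_simp
  ring

theorem pencilCnDn_eq_cos_half_mul {k : ℝ} (h0 : 0 < k) (h1 : k < 1) (u : ℝ) :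
    pencilCnDn k u = Real.cos (ellipticAmp ((1 + k ^ 2) / (2 * k)) u / 2) *
      (1 - k * pencilSn k u ^ 2) := by
  unfold pencilCnDn pencilSn
  generalize ellipticAmp ((1 + k ^ 2) / (2 * k)) u = t
  have hρ := Real.sq_sqrt (pencil_radicand_pos h0 h1 t).le
  have hp := Real.sqrt_pos.2 (pencil_radicand_pos h0 h1 t)
  rw [pencil_radicand_eq] at *
  generalize Real.sqrt _ = ρ at *
  have hs : Real.sin (t / 2) ^ 2 = (ρ ^ 2 - (1 - k) ^ 2) / (4 * k) := by
    field_simp; linarith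
  have hd : (1 - k) + ρ ≠ 0 := (add_pos (sub_pos.2 h1) hp).ne'
  simp only [div_pow, mul_pow, hs]
  field_simp
  ring

/-- Makes sn a root of a quadratic with coefficients in the half-angle sine; this identifies `sn v`
in `pencilSn_tangent`. -/
theorem sin_half_mul_one_sub {k : ℝ} (h0 : 0 < k) (h1 : k < 1) (u : ℝ) :
    Real.sin (ellipticAmp ((1 + k ^ 2) / (2 * k)) u / 2) * (1 - k * pencilSn k u ^ 2) =
      (1 - k) * pencilSn k u := by
  unfold pencilSn
  generalize ellipticAmp ((1 + k ^ 2) / (2 * k)) u = t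
  have hρ := Real.sq_sqrt (pencil_radicand_pos h0 h1 t).le
  have hp := Real.sqrt_pos.2 (pencil_radicand_pos h0 h1 t)
  rw [pencil_radicand_eq] at *
  generalize Real.sqrt _ = ρ at *
  have hs : Real.sin (t / 2) ^ 2 = (ρ ^ 2 - (1 - k) ^ 2) / (4 * k) := by
    field_simp; linarith
  have hd : (1 - k) + ρ ≠ 0 := (add_pos (sub_pos.2 h1) hp).ne'
  simp only [div_pow, mul_pow, hs]
  field_simp
  ring

theorem pencilSn_sq_le_one {k : ℝ} (h0 : 0 < k) (h1 : k < 1) (u : ℝ) : pencilSn k u ^ 2 ≤ 1 := by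
  unfold pencilSn
  generalize ellipticAmp ((1 + k ^ 2) / (2 * k)) u = t
  have hρ := Real.sq_sqrt (pencil_radicand_pos h0 h1 t).le
  have hp := Real.sqrt_pos.2 (pencil_radicand_pos h0 h1 t)
  rw [pencil_radicand_eq] at *
  generalize Real.sqrt _ = ρ at *
  have hs := Real.sin_sq_le_one (t / 2)
  have hd : 0 < (1 - k) + ρ := by linarith
  have hs0 := sq_nonneg (Real.sin (t / 2))
  generalize Real.sin (t / 2) = σ at *
  have hle : (1 - k) + ρ ≥ (2 : ℝ) * |σ| := by
    have h2 : |σ| ≤ 1 := (sq_le_one_iff_abs_le_one σ).1 hs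
    have h4 := abs_nonneg σ
    rw [← sq_abs σ] at hρ
    -- Squaring would give `0 < 4(1 - k)|σ|(|σ| - 1)`.
    by_contra! hlt
    have : ρ ^ 2 < (2 * |σ| - (1 - k)) ^ 2 := by
      apply pow_lt_pow_left₀ (by linarith) hp.le (by norm_num)
    nlinarith [mul_nonneg (mul_nonneg (sub_pos.2 h1).le h4) (sub_nonneg.2 h2)]
  rw [sq_le_one_iff_abs_le_one, abs_div, abs_mul, abs_two, abs_of_pos hd]
  exact (div_le_one hd).2 hle

/-- The factor `1/(2√(2k))` appears because `u` is measured by `Φ`, not by the Jacobi integral. -/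
theorem pencilSn_hasDerivAt {k : ℝ} (h0 : 0 < k) (h1 : k < 1) (u : ℝ) :
    HasDerivAt (pencilSn k) (pencilCnDn k u / (2 * Real.sqrt (2 * k))) u := by
  have hT := ellipticAmp_hasDerivAt (one_lt_of_modulus h0 h1) u
  have hp := Real.sqrt_pos.2
    (pencil_radicand_pos h0 h1 (ellipticAmp ((1 + k ^ 2) / (2 * k)) u))
  have hden : 0 < (1 - k) + Real.sqrt
      (1 + k ^ 2 - 2 * k * Real.cos (ellipticAmp ((1 + k ^ 2) / (2 * k)) u)) := by linarith
  have hrad : HasDerivAt (fun u => 1 + k ^ 2 - 2 * k *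
      Real.cos (ellipticAmp ((1 + k ^ 2) / (2 * k)) u)) _ u :=
    (hT.cos.const_mul (2 * k)).const_sub (1 + k ^ 2)
  have h := ((hT.div_const 2).sin.const_mul 2).div
    ((hrad.sqrt (pencil_radicand_pos h0 h1 _).ne').const_add (1 - k)) hden.ne'
  refine h.congr_deriv ?_
  have hR : Real.sqrt ((1 + k ^ 2) / (2 * k) - Real.cos (ellipticAmp ((1 + k ^ 2) / (2 * k)) u)) =
      Real.sqrt (1 + k ^ 2 - 2 * k * Real.cos (ellipticAmp ((1 + k ^ 2) / (2 * k)) u)) /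
        Real.sqrt (2 * k) := by
    rw [← Real.sqrt_div' _ (by positivity)]
    congr 1
    field_simp
  rw [hR]
  clear hR h hrad hT
  have hk : 0 < Real.sqrt (2 * k) := Real.sqrt_pos.2 (by positivity)
  unfold pencilCnDn
  have hρ := Real.sq_sqrt
    (pencil_radicand_pos h0 h1 (ellipticAmp ((1 + k ^ 2) / (2 * k)) u)).le
  generalize ellipticAmp ((1 + k ^ 2) / (2 * k)) u = t at *
  have hs2 : Real.sin t = 2 * Real.sin (t / 2) * Real.cos (t / 2) := by
    rw [← Real.sin_two_mul]; ring_nf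
  rw [hs2]
  rw [pencil_radicand_eq] at *
  generalize Real.sqrt (2 * k) = κ at *
  generalize Real.sqrt _ = ρ at *
  have hs' : 4 * k * Real.sin (t / 2) ^ 2 = (ρ ^ 2 - (1 - k) ^ 2) := by linarith
  field_simp
  linear_combination -Real.cos (t / 2) * hs'

theorem pencilCnDn_hasDerivAt {k : ℝ} (h0 : 0 < k) (h1 : k < 1) (u : ℝ) :
    HasDerivAt (pencilCnDn k) ((-(1 + k ^ 2) * pencilSn k u + 2 * k ^ 2 * pencilSn k u ^ 3) /
      (2 * Real.sqrt (2 * k))) u := by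
  have hT := ellipticAmp_hasDerivAt (one_lt_of_modulus h0 h1) u
  have hp := Real.sqrt_pos.2
    (pencil_radicand_pos h0 h1 (ellipticAmp ((1 + k ^ 2) / (2 * k)) u))
  have hden : 0 < (1 - k) + Real.sqrt
      (1 + k ^ 2 - 2 * k * Real.cos (ellipticAmp ((1 + k ^ 2) / (2 * k)) u)) := by linarith
  have hrad : HasDerivAt (fun u => 1 + k ^ 2 - 2 * k *
      Real.cos (ellipticAmp ((1 + k ^ 2) / (2 * k)) u)) _ u :=
    (hT.cos.const_mul (2 * k)).const_sub (1 + k ^ 2)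
  have h := ((hT.div_const 2).cos.const_mul (2 * (1 - k))).div
    ((hrad.sqrt (pencil_radicand_pos h0 h1 _).ne').const_add (1 - k)) hden.ne'
  refine h.congr_deriv ?_
  have hR : Real.sqrt ((1 + k ^ 2) / (2 * k) - Real.cos (ellipticAmp ((1 + k ^ 2) / (2 * k)) u)) =
      Real.sqrt (1 + k ^ 2 - 2 * k * Real.cos (ellipticAmp ((1 + k ^ 2) / (2 * k)) u)) /
        Real.sqrt (2 * k) := by
    rw [← Real.sqrt_div' _ (by positivity)]
    congr 1
    field_simp
  rw [hR]
  clear hR h hrad hT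
  have hk : 0 < Real.sqrt (2 * k) := Real.sqrt_pos.2 (by positivity)
  unfold pencilSn
  have hρ := Real.sq_sqrt
    (pencil_radicand_pos h0 h1 (ellipticAmp ((1 + k ^ 2) / (2 * k)) u)).le
  generalize ellipticAmp ((1 + k ^ 2) / (2 * k)) u = t at *
  have hs2 : Real.sin t = 2 * Real.sin (t / 2) * Real.cos (t / 2) := by
    rw [← Real.sin_two_mul]; ring_nf
  have hcc : Real.cos (t / 2) ^ 2 = 1 - Real.sin (t / 2) ^ 2 := by
    linarith [Real.sin_sq_add_cos_sq (t / 2)]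
  rw [hs2]
  rw [pencil_radicand_eq] at *
  generalize Real.sqrt (2 * k) = κ at *
  generalize Real.sqrt _ = ρ at *
  have hs' : 4 * k * Real.sin (t / 2) ^ 2 = (ρ ^ 2 - (1 - k) ^ 2) := by linarith
  generalize Real.sin (t / 2) = σ at *
  generalize Real.cos (t / 2) = τ at *
  field_simp
  linear_combination -σ * (1 - k) * (1 - k + ρ) * 4 * k * hcc +
    σ * ((1 - k) * (1 - k + ρ) - 2 * k) * hs'

theorem pencilSn_zero {k : ℝ} (h0 : 0 < k) (h1 : k < 1) : pencilSn k 0 = 0 := by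
  simp [pencilSn, ellipticAmp_zero (one_lt_of_modulus h0 h1)]

theorem pencilCnDn_zero {k : ℝ} (h0 : 0 < k) (h1 : k < 1) : pencilCnDn k 0 = 1 := by
  rw [pencilCnDn_eq_cos_half_mul h0 h1, pencilSn_zero h0 h1,
    ellipticAmp_zero (one_lt_of_modulus h0 h1)]
  simp

theorem pencilSn_neg {k : ℝ} (h0 : 0 < k) (h1 : k < 1) (u : ℝ) :
    pencilSn k (-u) = -pencilSn k u := by
  simp [pencilSn, ellipticAmp_neg (one_lt_of_modulus h0 h1), neg_div]

theorem pencilCnDn_neg {k : ℝ} (h0 : 0 < k) (h1 : k < 1) (u : ℝ) :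
    pencilCnDn k (-u) = pencilCnDn k u := by
  simp [pencilCnDn, ellipticAmp_neg (one_lt_of_modulus h0 h1), neg_div]

theorem pencilSn_add_period {k : ℝ} (h0 : 0 < k) (h1 : k < 1) (u : ℝ) :
    pencilSn k (u + 2 * ellipticPhi Real.pi ((1 + k ^ 2) / (2 * k))) = -pencilSn k u := by
  rw [pencilSn, ellipticAmp_add_period (one_lt_of_modulus h0 h1), add_div _ (2 * Real.pi),
    mul_div_cancel_left₀ _ two_ne_zero, Real.sin_add_pi, Real.cos_add_two_pi, pencilSn,
    mul_neg, neg_div]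

theorem pencil_denominator_pos {k : ℝ} (h0 : 0 < k) (h1 : k < 1) (u v : ℝ) :
    0 < 1 - k ^ 2 * pencilSn k u ^ 2 * pencilSn k v ^ 2 := by
  have hu := pencilSn_sq_le_one h0 h1 u
  have hv := pencilSn_sq_le_one h0 h1 v
  have := mul_le_one₀ hu (sq_nonneg _) hv
  nlinarith [sq_nonneg k]

/-! ### Addition theorem and monotonicity -/

theorem pencilSn_add {k : ℝ} (h0 : 0 < k) (h1 : k < 1) (u v : ℝ) :
    pencilSn k (u + v) = (pencilSn k u * pencilCnDn k v + pencilCnDn k u * pencilSn k v) /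
      (1 - k ^ 2 * pencilSn k u ^ 2 * pencilSn k v ^ 2) := by
  set c := u + v with hc
  have key : ∀ a, HasDerivAt (fun a => (pencilSn k a * pencilCnDn k (c - a) +
      pencilCnDn k a * pencilSn k (c - a)) /
      (1 - k ^ 2 * pencilSn k a ^ 2 * pencilSn k (c - a) ^ 2)) 0 a := by
    intro a
    have hx := pencilSn_hasDerivAt h0 h1 a
    have hy := pencilCnDn_hasDerivAt h0 h1 a
    have hx' := (pencilSn_hasDerivAt h0 h1 (c - a)).comp_const_sub c a
    have hy' := (pencilCnDn_hasDerivAt h0 h1 (c - a)).comp_const_sub c a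
    have hD := pencil_denominator_pos h0 h1 a (c - a)
    have h := ((hx.mul hy').add (hy.mul hx')).div
      ((((hx.pow 2).const_mul (k ^ 2)).mul (hx'.pow 2)).const_sub 1) hD.ne'
    refine h.congr_deriv ?_
    have hk : 0 < Real.sqrt (2 * k) := Real.sqrt_pos.2 (by positivity)
    have e1 := pencilCnDn_sq h0 h1 a
    have e2 := pencilCnDn_sq h0 h1 (c - a)
    simp only [Pi.add_apply, Pi.mul_apply, Pi.pow_apply]
    generalize pencilSn k a = x at *
    generalize pencilCnDn k a = y at *
    generalize pencilSn k (c - a) = z at *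
    generalize pencilCnDn k (c - a) = w at *
    generalize Real.sqrt (2 * k) = κ at *
    rw [div_eq_zero_iff]
    left
    norm_num
    field_simp
    linear_combination 2 * k ^ 2 * x * z * (z ^ 2 * e1 - x ^ 2 * e2)
  -- The quotient is constant along arguments of fixed sum; at `a = u + v` the second argument is
  -- `0` and it reduces to sn.
  have hconst := is_const_of_deriv_eq_zero (fun a => (key a).differentiableAt)
    (fun a => (key a).deriv) u c
  simp only [sub_self, pencilSn_zero h0 h1, pencilCnDn_zero h0 h1,
    show c - u = v by rw [hc]; ring] at hconst
  rw [hconst]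
  simp

theorem pencilSn_add_mul_sub {k : ℝ} (h0 : 0 < k) (h1 : k < 1) (u v : ℝ) :
    pencilSn k (u + v) * pencilSn k (u - v) = (pencilSn k u ^ 2 - pencilSn k v ^ 2) /
      (1 - k ^ 2 * pencilSn k u ^ 2 * pencilSn k v ^ 2) := by
  have hD := pencil_denominator_pos h0 h1 u v
  rw [sub_eq_add_neg, pencilSn_add h0 h1, pencilSn_add h0 h1, pencilSn_neg h0 h1,
    pencilCnDn_neg h0 h1, neg_sq]
  have e1 := pencilCnDn_sq h0 h1 u
  have e2 := pencilCnDn_sq h0 h1 v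
  have hD' := hD.ne'
  rw [div_mul_div_comm, div_eq_div_iff (mul_pos hD hD).ne' hD']
  linear_combination (1 - k ^ 2 * pencilSn k u ^ 2 * pencilSn k v ^ 2) *
    (pencilSn k u ^ 2 * e2 - pencilSn k v ^ 2 * e1)

theorem pencilSn_strictMonoOn {k : ℝ} (h0 : 0 < k) (h1 : k < 1) :
    StrictMonoOn (pencilSn k) (Set.Icc 0 (ellipticPhi Real.pi ((1 + k ^ 2) / (2 * k)))) := by
  have hI := one_lt_of_modulus h0 h1
  refine strictMonoOn_of_deriv_pos (convex_Icc _ _)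
    (fun u _ => (pencilSn_hasDerivAt h0 h1 u).continuousAt.continuousWithinAt) fun u hu => ?_
  rw [interior_Icc] at hu
  rw [(pencilSn_hasDerivAt h0 h1 u).deriv]
  have ha := ellipticAmp_strictMono hI hu.1
  have hb := ellipticAmp_strictMono hI hu.2
  rw [ellipticAmp_zero hI] at ha
  rw [ellipticAmp_ellipticPhi hI] at hb
  have hcos : 0 < Real.cos (ellipticAmp ((1 + k ^ 2) / (2 * k)) u / 2) :=
    Real.cos_pos_of_mem_Ioo ⟨by linarith [Real.pi_pos], by linarith⟩
  have hp := Real.sqrt_pos.2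
    (pencil_radicand_pos h0 h1 (ellipticAmp ((1 + k ^ 2) / (2 * k)) u))
  have hk : 0 < 1 - k := sub_pos.2 h1
  unfold pencilCnDn
  positivity

/-! ### Best approximations and record minima -/

theorem distNearestInt_eq_abs_sub_round (x : ℝ) : distNearestInt x = |x - round x| :=
  (abs_sub_round_eq_min x).symm

theorem distNearestInt_nonneg (x : ℝ) : 0 ≤ distNearestInt x := by
  rw [distNearestInt_eq_abs_sub_round]; exact abs_nonneg _

theorem distNearestInt_le_half (x : ℝ) : distNearestInt x ≤ 1 / 2 := by
  rw [distNearestInt_eq_abs_sub_round]; exact abs_sub_round x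

theorem exists_isBestApprox_iff (α : ℝ) (q : ℕ) :
    (∃ p : ℤ, IsBestApprox α p q) ↔ IsRecordMin (fun n : ℕ => distNearestInt (n * α)) q := by
  constructor
  · rintro ⟨p, hq, hp, h⟩
    exact ⟨hq, fun j h1 h2 => by simpa only [hp] using h j h1 h2⟩
  · rintro ⟨hq, h⟩
    have hp := distNearestInt_eq_abs_sub_round (q * α)
    exact ⟨round (q * α), hq, hp, fun j h1 h2 => hp ▸ h j h1 h2⟩

theorem exists_distNearestInt_lt (α : ℝ) {ε : ℝ} (hε : 0 < ε) :
    ∃ n : ℕ, 1 ≤ n ∧ distNearestInt (n * α) < ε := by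
  obtain ⟨N, hN⟩ := exists_nat_one_div_lt hε
  obtain ⟨n, h0, -, h⟩ := Real.exists_nat_abs_mul_sub_round_le α N.succ_pos
  refine ⟨n, h0, ?_⟩
  rw [distNearestInt_eq_abs_sub_round]
  refine (h.trans ?_).trans_lt hN
  apply one_div_le_one_div_of_le (by positivity)
  push_cast
  linarith

theorem distNearestInt_pos_of_irrational {α : ℝ} (hα : Irrational α) {n : ℕ} (hn : 1 ≤ n) :
    0 < distNearestInt (n * α) := by
  rw [distNearestInt_eq_abs_sub_round, abs_pos, sub_ne_zero]
  exact (hα.natCast_mul (by omega)).ne_int _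

theorem exists_isRecordMin_lt {u : ℕ → ℝ} {ε : ℝ} (h : ∃ n, 1 ≤ n ∧ u n < ε) :
    ∃ q, IsRecordMin u q ∧ u q < ε := by
  classical
  let n := Nat.find h
  have hn : 1 ≤ n ∧ u n < ε := Nat.find_spec h
  refine ⟨n, ⟨hn.1, fun k hk hkn => ?_⟩, hn.2⟩
  have := Nat.find_min h hkn
  exact hn.2.trans_le (not_lt.1 fun h' => this ⟨hk, h'⟩)

theorem exists_strictMono_isRecordMin {u : ℕ → ℝ} (hpos : ∀ n, 1 ≤ n → 0 < u n)
    (hsmall : ∀ ε > 0, ∃ n, 1 ≤ n ∧ u n < ε) :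
    ∃ q : ℕ → ℕ, StrictMono q ∧ Set.range q = {n : ℕ | IsRecordMin u n} ∧
      StrictAnti (fun j => u (q j)) ∧ Tendsto (fun j => u (q j)) atTop (𝓝 0) := by
  have hinf : {n : ℕ | IsRecordMin u n}.Infinite := by
    intro hfin
    obtain ⟨q₀, hq₀, -⟩ := exists_isRecordMin_lt (hsmall 1 one_pos)
    -- Were there finitely many records, the first term below the least record value would be a
    -- further record.
    obtain ⟨a, ha, hmin⟩ := hfin.exists_minimalFor u _ ⟨q₀, hq₀⟩
    obtain ⟨b, hb, hlt⟩ := exists_isRecordMin_lt (hsmall (u a) (hpos a ha.1))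
    exact (hmin hb hlt.le).not_gt hlt
  have hmono := Nat.nth_strictMono hinf
  have hmem : ∀ j, IsRecordMin u (Nat.nth (IsRecordMin u) j) := fun j =>
    Nat.nth_mem_of_infinite hinf j
  have hanti : StrictAnti (fun j => u (Nat.nth (IsRecordMin u) j)) := fun i j hij =>
    (hmem j).2 _ (hmem i).1 (hmono hij)
  refine ⟨Nat.nth (IsRecordMin u), hmono, Nat.range_nth_of_infinite hinf, hanti, ?_⟩
  rw [Metric.tendsto_atTop]
  intro ε hε
  obtain ⟨q, hq, hlt⟩ := exists_isRecordMin_lt (hsmall ε hε)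
  obtain ⟨N, rfl⟩ := (Nat.range_nth_of_infinite hinf).ge hq
  refine ⟨N, fun n hn => ?_⟩
  rw [Real.dist_0_eq_abs, abs_of_pos (hpos _ (hmem n).1)]
  exact (hanti.antitone hn).trans_lt hlt

/-! ### The recurrence up to and beyond a zero -/

theorem gammaSeq_eq_of_ne_zero {c r : ℝ} {g : ℕ → ℝ} (h1 : g 1 = 1)
    (h2 : g 2 = 2 * r / (1 - c ^ 2))
    (hrec : ∀ n, 1 ≤ n →
      g (n + 2) * g n = |1 - g (n + 1) ^ 2| / (1 - c ^ 2 * g (n + 1) ^ 2)) (n : ℕ) (hn : 1 ≤ n)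
    (hne : ∀ j, 1 ≤ j → j + 1 < n → g j ≠ 0) : gammaSeq c r n = g n := by
  induction n using Nat.strong_induction_on with
  | _ n ih =>
    match n, hn with
    | 1, _ => rw [gammaSeq, h1]
    | 2, _ => rw [gammaSeq, h2]
    | k + 3, _ =>
      rw [gammaSeq, ih (k + 2) (by omega) (by omega) fun j hj hj' => hne j hj (by omega),
        ih (k + 1) (by omega) (by omega) fun j hj hj' => hne j hj (by omega), ← div_div,
        ← hrec (k + 1) (by omega), mul_div_cancel_right₀ _ (hne (k + 1) (by omega) (by omega))]

theorem gammaSeq_after_zero {c r : ℝ} {m : ℕ} (hm : 1 ≤ m) (h0 : gammaSeq c r m = 0)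
    (h1 : gammaSeq c r (m + 1) = 1) (i : ℕ) :
    gammaSeq c r (m + 2 * i) = 0 ∧ gammaSeq c r (m + 2 * i + 1) = 1 := by
  induction i with
  | zero => exact ⟨h0, h1⟩
  | succ i ih =>
    obtain ⟨a, ha⟩ : ∃ a, m + 2 * i = a + 1 := ⟨m + 2 * i - 1, by omega⟩
    rw [show m + 2 * (i + 1) = a + 3 by omega]
    rw [ha] at ih
    have h : gammaSeq c r (a + 3) = 0 := by rw [gammaSeq, ih.1, ih.2]; simp
    refine ⟨h, ?_⟩
    rw [show a + 3 + 1 = (a + 1) + 3 by omega, gammaSeq, ih.2, h]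
    simp

/-- Up to its first zero `gammaSeq` agrees with any nonnegative solution `g` of the recurrence and
of the tangency equation; from then on it alternates between `0` and `1`. -/
theorem gammaSeq_cases {c r : ℝ} (hc : c ≠ 0) {g : ℕ → ℝ} (hg : ∀ n, 0 ≤ g n) (h1 : g 1 = 1)
    (h2 : g 2 = 2 * r / (1 - c ^ 2))
    (hrec : ∀ n, 1 ≤ n →
      g (n + 2) * g n = |1 - g (n + 1) ^ 2| / (1 - c ^ 2 * g (n + 1) ^ 2))
    (htan : ∀ n, tangencyPoly c r (c * g n ^ 2) (c * g (n + 1) ^ 2) = 0) (n : ℕ) :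
    (∀ j, 1 ≤ j → j < n → g j ≠ 0) ∨
      ∃ m i, 1 ≤ m ∧ m < n ∧ g m = 0 ∧ gammaSeq c r m = 0 ∧ (n = m + 2 * i ∨ n = m + 2 * i + 1) ∧
        ∀ i, gammaSeq c r (m + 2 * i) = 0 ∧ gammaSeq c r (m + 2 * i + 1) = 1 := by
  classical
  by_cases h : ∃ j, 1 ≤ j ∧ j < n ∧ g j = 0
  · right
    obtain ⟨hm1, hmn, hm0⟩ := Nat.find_spec h
    have hmin : ∀ j, 1 ≤ j → j < Nat.find h → g j ≠ 0 := fun j hj hjm h0 =>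
      Nat.find_min h hjm ⟨hj, hjm.trans hmn, h0⟩
    generalize Nat.find h = m at *
    have e0 : gammaSeq c r m = 0 := by
      rw [gammaSeq_eq_of_ne_zero h1 h2 hrec m hm1 fun j hj hj' => hmin j hj (by omega), hm0]
    have hone : g (m + 1) = 1 := by
      have := htan m
      rw [hm0, tangencyPoly] at this
      -- At `w = 0` the tangency equation degenerates to a square, which forces the next term to be
      -- `1`.
      have h3 : (c * (1 - g (m + 1) ^ 2)) ^ 2 = 0 := by linear_combination this
      have h4 : g (m + 1) ^ 2 = 1 := by
        have := (mul_eq_zero.1 (pow_eq_zero_iff two_ne_zero |>.1 h3)).resolve_left hc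
        linarith
      exact (pow_eq_one_iff_of_nonneg (hg _) two_ne_zero).1 h4
    have e1 : gammaSeq c r (m + 1) = 1 := by
      rw [gammaSeq_eq_of_ne_zero h1 h2 hrec (m + 1) (by omega)
        fun j hj hj' => hmin j hj (by omega), hone]
    exact ⟨m, (n - m) / 2, hm1, hmn, hm0, e0, by omega, gammaSeq_after_zero hm1 e0 e1⟩
  · left
    exact fun j hj hjn h0 => h ⟨j, hj, hjn, h0⟩

theorem tangencyPoly_gammaSeq {c r : ℝ} (hc : c ≠ 0) {g : ℕ → ℝ} (hg : ∀ n, 0 ≤ g n)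
    (h1 : g 1 = 1) (h2 : g 2 = 2 * r / (1 - c ^ 2))
    (hrec : ∀ n, 1 ≤ n →
      g (n + 2) * g n = |1 - g (n + 1) ^ 2| / (1 - c ^ 2 * g (n + 1) ^ 2))
    (htan : ∀ n, tangencyPoly c r (c * g n ^ 2) (c * g (n + 1) ^ 2) = 0) (n : ℕ) (hn : 1 ≤ n) :
    tangencyPoly c r (c * gammaSeq c r n ^ 2) (c * gammaSeq c r (n + 1) ^ 2) = 0 := by
  rcases gammaSeq_cases hc hg h1 h2 hrec htan n with h | ⟨m, i, -, -, -, -, hn' | hn', hm⟩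
  · rw [gammaSeq_eq_of_ne_zero h1 h2 hrec n hn fun j hj hj' => h j hj (by omega),
      gammaSeq_eq_of_ne_zero h1 h2 hrec (n + 1) (by omega) fun j hj hj' => h j hj (by omega)]
    exact htan n
  · rw [hn', (hm i).1, (hm i).2, tangencyPoly]
    ring
  · rw [hn', (hm i).2, show m + 2 * i + 1 + 1 = m + 2 * (i + 1) by ring, (hm (i + 1)).1,
      tangencyPoly]
    ring

/-- After a common zero at `m < q`, nonnegativity excludes `q` as a record of either sequence, so
their later disagreement is harmless. -/
theorem isRecordMin_gammaSeq_iff {c r : ℝ} (hc : c ≠ 0) {g : ℕ → ℝ} (hg : ∀ n, 0 ≤ g n)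
    (h1 : g 1 = 1) (h2 : g 2 = 2 * r / (1 - c ^ 2))
    (hrec : ∀ n, 1 ≤ n →
      g (n + 2) * g n = |1 - g (n + 1) ^ 2| / (1 - c ^ 2 * g (n + 1) ^ 2))
    (htan : ∀ n, tangencyPoly c r (c * g n ^ 2) (c * g (n + 1) ^ 2) = 0) (q : ℕ) :
    IsRecordMin (gammaSeq c r) q ↔ IsRecordMin g q := by
  refine and_congr_right fun hq => ?_
  rcases gammaSeq_cases hc hg h1 h2 hrec htan q with h | ⟨m, i, hm1, hmq, hgm, h0, hq', hm⟩
  · have e : ∀ n, 1 ≤ n → n ≤ q → gammaSeq c r n = g n := fun n hn hnq =>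
      gammaSeq_eq_of_ne_zero h1 h2 hrec n hn fun j hj hj' => h j hj (by omega)
    refine forall_congr' fun k => forall_congr' fun hk => forall_congr' fun hkq => ?_
    rw [e k hk hkq.le, e q hq le_rfl]
  · have hnn : 0 ≤ gammaSeq c r q := by
      rcases hq' with rfl | rfl
      · exact (hm i).1.ge
      · rw [(hm i).2]; exact zero_le_one
    constructor
    · intro H; exact absurd (H m hm1 hmq) (by rw [h0]; exact hnn.not_gt)
    · intro H; exact absurd (H m hm1 hmq) (by rw [hgm]; exact (hg q).not_gt)

/-! ### From sn to the circles and to θ -/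

theorem ellipticPhi_pi_pos {I : ℝ} (hI : 1 < I) : 0 < ellipticPhi Real.pi I := by
  have := ellipticPhi_strictMono hI Real.pi_pos
  simpa [ellipticPhi_zero] using this

theorem pencilSn_nonneg {k : ℝ} (h0 : 0 < k) (h1 : k < 1) {u : ℝ} (hu0 : 0 ≤ u)
    (hu : u ≤ ellipticPhi Real.pi ((1 + k ^ 2) / (2 * k))) : 0 ≤ pencilSn k u := by
  rw [← pencilSn_zero h0 h1]
  exact (pencilSn_strictMonoOn h0 h1).monotoneOn ⟨le_rfl, hu0.trans hu⟩ ⟨hu0, hu⟩ hu0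

theorem abs_pencilSn_eq {k : ℝ} (h0 : 0 < k) (h1 : k < 1) (α : ℝ) :
    |pencilSn k (α * (2 * ellipticPhi Real.pi ((1 + k ^ 2) / (2 * k))))| =
      pencilSn k (distNearestInt α * (2 * ellipticPhi Real.pi ((1 + k ^ 2) / (2 * k)))) := by
  have hP := ellipticPhi_pi_pos (one_lt_of_modulus h0 h1)
  have hper : Function.Periodic (fun u => |pencilSn k u|)
      (2 * ellipticPhi Real.pi ((1 + k ^ 2) / (2 * k))) := fun u => by
    simp only [pencilSn_add_period h0 h1, abs_neg]
  have hnn := pencilSn_nonneg h0 h1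
    (u := distNearestInt α * (2 * ellipticPhi Real.pi ((1 + k ^ 2) / (2 * k))))
    (mul_nonneg (distNearestInt_nonneg α) (by positivity))
    (by nlinarith [distNearestInt_le_half α])
  have h := hper.sub_int_mul_eq (x := α * (2 * ellipticPhi Real.pi ((1 + k ^ 2) / (2 * k))))
    (round α)
  rw [← abs_of_nonneg hnn, distNearestInt_eq_abs_sub_round]
  simp only [← sub_mul] at h
  rw [← h]
  rcases abs_choice (α - round α) with h' | h' <;> rw [h']
  rw [neg_mul, pencilSn_neg h0 h1, abs_neg]

theorem abs_pencilSn_lt_iff {k : ℝ} (h0 : 0 < k) (h1 : k < 1) (α β : ℝ) :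
    |pencilSn k (α * (2 * ellipticPhi Real.pi ((1 + k ^ 2) / (2 * k))))| <
      |pencilSn k (β * (2 * ellipticPhi Real.pi ((1 + k ^ 2) / (2 * k))))| ↔
      distNearestInt α < distNearestInt β := by
  have hP := ellipticPhi_pi_pos (one_lt_of_modulus h0 h1)
  have hmem : ∀ α, distNearestInt α * (2 * ellipticPhi Real.pi ((1 + k ^ 2) / (2 * k))) ∈
      Set.Icc 0 (ellipticPhi Real.pi ((1 + k ^ 2) / (2 * k))) := fun α =>
    ⟨mul_nonneg (distNearestInt_nonneg α) (by positivity),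
      by nlinarith [distNearestInt_le_half α]⟩
  rw [abs_pencilSn_eq h0 h1, abs_pencilSn_eq h0 h1,
    (pencilSn_strictMonoOn h0 h1).lt_iff_lt (hmem α) (hmem β)]
  exact mul_lt_mul_iff_left₀ (by positivity)

theorem exists_modulus {I : ℝ} (hI : 1 < I) :
    ∃ k : ℝ, 0 < k ∧ k < 1 ∧ I = (1 + k ^ 2) / (2 * k) := by
  have h := Real.sq_sqrt (show 0 ≤ I ^ 2 - 1 by nlinarith)
  have hn := Real.sqrt_nonneg (I ^ 2 - 1)
  generalize Real.sqrt (I ^ 2 - 1) = w at *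
  have hw : w < I := by nlinarith
  -- The smaller root of `k² - 2Ik + 1`.
  refine ⟨I - w, by linarith, by nlinarith, ?_⟩
  rw [eq_div_iff (by linarith)]
  linear_combination -h

theorem one_lt_pencilAbscissa {c r : ℝ} (hc : 0 < c) (hr : 0 < r) (hcr : c + r < 1) :
    1 < pencilAbscissa c r := by
  rw [pencilAbscissa, lt_div_iff₀ (by positivity)]
  nlinarith

theorem cos_half_eq {c r φ : ℝ} (hr : 0 < r) (hcr : c + r < 1) (hφ0 : 0 < φ) (hφπ : φ < Real.pi)
    (hφ : Real.cos φ = 2 * r ^ 2 / (1 - c) ^ 2 - 1) : Real.cos (φ / 2) = r / (1 - c) := by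
  have hpos : 0 < Real.cos (φ / 2) :=
    Real.cos_pos_of_mem_Ioo ⟨by linarith [Real.pi_pos], by linarith⟩
  have h1c : 0 < 1 - c := by linarith
  refine (pow_left_inj₀ hpos.le (by positivity) two_ne_zero).1 ?_
  rw [Real.cos_sq, mul_div_cancel₀ _ two_ne_zero, hφ]
  field_simp
  ring

theorem pencilSn_tangent {c r φ k : ℝ} (hc : 0 < c) (hr : 0 < r) (hcr : c + r < 1)
    (hφ0 : 0 < φ) (hφπ : φ < Real.pi) (hφ : Real.cos φ = 2 * r ^ 2 / (1 - c) ^ 2 - 1)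
    (h0 : 0 < k) (h1 : k < 1) (hI : pencilAbscissa c r = (1 + k ^ 2) / (2 * k)) :
    0 < pencilSn k (ellipticPhi φ ((1 + k ^ 2) / (2 * k))) ∧
      k * pencilSn k (ellipticPhi φ ((1 + k ^ 2) / (2 * k))) ^ 2 = c ∧
      pencilCnDn k (ellipticPhi φ ((1 + k ^ 2) / (2 * k))) = r := by
  have hamp := ellipticAmp_ellipticPhi (one_lt_of_modulus h0 h1) φ
  have hcos := cos_half_eq hr hcr hφ0 hφπ hφ
  have hσ : 0 < Real.sin (φ / 2) := Real.sin_pos_of_pos_of_lt_pi (by linarith) (by linarith)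
  have hsn := sin_half_mul_one_sub h0 h1 (ellipticPhi φ ((1 + k ^ 2) / (2 * k)))
  have hcd := pencilCnDn_eq_cos_half_mul h0 h1 (ellipticPhi φ ((1 + k ^ 2) / (2 * k)))
  have h1c : 0 < 1 - c := by linarith
  have h1k : 0 < 1 - k := by linarith
  have hpos : 0 < pencilSn k (ellipticPhi φ ((1 + k ^ 2) / (2 * k))) := by
    have := Real.sqrt_pos.2 (pencil_radicand_pos h0 h1 φ)
    rw [pencilSn, hamp]
    positivity
  rw [hamp] at hsn hcd
  rw [hcos] at hcd
  have hss : Real.sin (φ / 2) ^ 2 = 1 - (r / (1 - c)) ^ 2 := by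
    rw [← hcos]; linarith [Real.sin_sq_add_cos_sq (φ / 2)]
  have hkey : k * pencilSn k (ellipticPhi φ ((1 + k ^ 2) / (2 * k))) ^ 2 = c := by
    generalize pencilSn k (ellipticPhi φ ((1 + k ^ 2) / (2 * k))) = s at *
    have ht := Real.sq_sqrt (show 0 ≤ c / k by positivity)
    have htp := Real.sqrt_pos.2 (show 0 < c / k by positivity)
    generalize Real.sqrt (c / k) = t at *
    have htc : k * t ^ 2 = c := by rw [ht]; field_simp
    have hlin : Real.sin (φ / 2) * (1 - c) = (1 - k) * t := by
      refine (pow_left_inj₀ (by positivity) (by positivity) two_ne_zero).1 ?_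
      rw [mul_pow, mul_pow, ht, hss]
      rw [pencilAbscissa, div_eq_div_iff (by positivity) (by positivity)] at hI
      field_simp
      linear_combination hI / 2
    -- Both `s` and `t = √(c/k)` are positive roots of `sin(φ/2)(1 - k x²) = (1 - k) x`, which has
    -- only one.
    have hprod : Real.sin (φ / 2) * ((t - s) * (1 + k * s * t)) = 0 := by
      rw [← htc] at hlin
      linear_combination t * hsn - s * hlin
    have hts : t - s = 0 :=
      ((mul_eq_zero.1 hprod).resolve_left hσ.ne' |> mul_eq_zero.1).resolve_right (by positivity)
    rw [← sub_eq_zero.1 hts, htc]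
  refine ⟨hpos, hkey, ?_⟩
  rw [hcd, hkey]
  field_simp

theorem tangencyPoly_pencilSn_add {k : ℝ} (h0 : 0 < k) (h1 : k < 1) (u v : ℝ) :
    tangencyPoly (k * pencilSn k v ^ 2) (pencilCnDn k v) (k * pencilSn k u ^ 2)
      (k * pencilSn k (u + v) ^ 2) = 0 := by
  have hD := pencil_denominator_pos h0 h1 u v
  have e1 := pencilCnDn_sq h0 h1 u
  have e2 := pencilCnDn_sq h0 h1 v
  have ha := pencilSn_add h0 h1 u v
  rw [eq_div_iff hD.ne'] at ha
  rw [tangencyPoly]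
  generalize pencilSn k (u + v) = X at *
  generalize pencilSn k u = x at *
  generalize pencilCnDn k u = y at *
  generalize pencilSn k v = s at *
  generalize pencilCnDn k v = r at *
  -- The quadratic with roots `sn(u + v)` and `sn(u - v)`. The tangency polynomial is a difference
  -- of squares, and `-k` times this quadratic is one factor.
  have hq : X ^ 2 * (1 - k ^ 2 * x ^ 2 * s ^ 2) - 2 * r * x * X + x ^ 2 - s ^ 2 = 0 := by
    refine (mul_eq_zero.1 ?_).resolve_right hD.ne'
    linear_combination (X * (1 - k ^ 2 * x ^ 2 * s ^ 2) + (x * r + y * s) - 2 * r * x) * ha +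
      s ^ 2 * e1 - x ^ 2 * e2
  linear_combination (-k) * (k * s ^ 2 * (k * X ^ 2) * (k * x ^ 2) - k * X ^ 2 - k * x ^ 2 +
    k * s ^ 2 - 2 * k * r * x * X) * hq

theorem theorem1 (c r φ : ℝ) (hc : 0 < c) (hr : 0 < r) (hcr : c + r < 1)
    (hφ0 : 0 < φ) (hφπ : φ < Real.pi)
    (hφ : Real.cos φ = 2 * r ^ 2 / (1 - c) ^ 2 - 1)
    (I θ : ℝ) (hI : I = pencilAbscissa c r)
    (hθ : θ = ellipticPhi φ I / (2 * ellipticPhi Real.pi I)) :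
    (∀ k : ℕ, 1 ≤ k →
      tangencyPoly c r (c * gammaSeq c r k ^ 2) (c * gammaSeq c r (k + 1) ^ 2) = 0) ∧
    (∀ q : ℕ, IsRecordMin (gammaSeq c r) q ↔ ∃ p : ℤ, IsBestApprox θ p q) ∧
    (Irrational θ →
      (∀ k : ℕ, 1 ≤ k → 0 < gammaSeq c r k) ∧
      ∃ q : ℕ → ℕ, StrictMono q ∧
        Set.range q = {n : ℕ | IsRecordMin (gammaSeq c r) n} ∧
        StrictAnti (fun j => gammaSeq c r (q j)) ∧
        Tendsto (fun j => gammaSeq c r (q j)) atTop (𝓝 0)) := by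
  have hI1 := one_lt_pencilAbscissa hc hr hcr
  rw [← hI] at hI1
  obtain ⟨k, h0, h1, hk⟩ := exists_modulus hI1
  obtain ⟨hs, hsc, hsr⟩ := pencilSn_tangent hc hr hcr hφ0 hφπ hφ h0 h1 (hI.symm.trans hk)
  rw [hk] at hθ
  have hP := ellipticPhi_pi_pos (one_lt_of_modulus h0 h1)
  have hv : ellipticPhi φ ((1 + k ^ 2) / (2 * k)) =
      θ * (2 * ellipticPhi Real.pi ((1 + k ^ 2) / (2 * k))) := by
    rw [hθ, div_mul_cancel₀ _ (by positivity)]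
  set v := ellipticPhi φ ((1 + k ^ 2) / (2 * k)) with hvdef
  set P := ellipticPhi Real.pi ((1 + k ^ 2) / (2 * k)) with hPdef
  set s := pencilSn k v with hsdef
  let g : ℕ → ℝ := fun n => |pencilSn k (n * v)| / s
  have hg : ∀ n, 0 ≤ g n := fun n => by positivity
  have hgsq : ∀ n, g n ^ 2 = pencilSn k (n * v) ^ 2 / s ^ 2 := fun n => by
    simp only [g, div_pow, sq_abs]
  have hcg : ∀ n, c * g n ^ 2 = k * pencilSn k (n * v) ^ 2 := fun n => by
    rw [hgsq, ← hsc]; field_simp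
  have g1 : g 1 = 1 := by
    simp only [g, Nat.cast_one, one_mul, ← hsdef, abs_of_pos hs]
    exact div_self hs.ne'
  have g2 : g 2 = 2 * r / (1 - c ^ 2) := by
    have hD := pencil_denominator_pos h0 h1 v v
    have h := pencilSn_add h0 h1 v v
    have hcD : 1 - k ^ 2 * pencilSn k v ^ 2 * pencilSn k v ^ 2 = 1 - c ^ 2 := by
      rw [← hsc]; ring
    rw [hcD] at h hD
    rw [hsr, ← hsdef] at h
    simp only [g, Nat.cast_ofNat, two_mul v, h]
    rw [abs_of_nonneg (by positivity)]
    field_simp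
    ring
  have hrec : ∀ n, 1 ≤ n →
      g (n + 2) * g n = |1 - g (n + 1) ^ 2| / (1 - c ^ 2 * g (n + 1) ^ 2) := by
    intro n _
    have h := pencilSn_add_mul_sub h0 h1 ((n + 1 : ℕ) * v) v
    have hD := pencil_denominator_pos h0 h1 ((n + 1 : ℕ) * v) v
    rw [show ((n + 1 : ℕ) : ℝ) * v + v = (n + 2 : ℕ) * v by push_cast; ring,
      show ((n + 1 : ℕ) : ℝ) * v - v = n * v by push_cast; ring] at h
    have hD' : 1 - c ^ 2 * g (n + 1) ^ 2 =
        1 - k ^ 2 * pencilSn k ((n + 1 : ℕ) * v) ^ 2 * s ^ 2 := by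
      rw [sq c, mul_assoc, hcg, ← hsc]; ring
    simp only [g] at *
    rw [hD', div_mul_div_comm, ← abs_mul, h, abs_div, abs_of_pos hD, div_pow, sq_abs,
      one_sub_div (by positivity), abs_div, abs_of_pos (show 0 < s ^ 2 by positivity),
      abs_sub_comm, ← sq s, div_div, div_div, mul_comm (s ^ 2)]
  have htan : ∀ n, tangencyPoly c r (c * g n ^ 2) (c * g (n + 1) ^ 2) = 0 := by
    intro n
    have h := tangencyPoly_pencilSn_add h0 h1 (n * v) v
    rw [hcg, hcg]
    rw [← hsdef, hsc, hsr] at h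
    convert h using 5
    push_cast; ring
  have hlt : ∀ m n : ℕ, g m < g n ↔ distNearestInt (m * θ) < distNearestInt (n * θ) := by
    intro m n
    simp only [g, div_lt_div_iff_of_pos_right hs, hv, ← mul_assoc (_ : ℝ) θ]
    exact abs_pencilSn_lt_iff h0 h1 _ _
  refine ⟨tangencyPoly_gammaSeq hc.ne' hg g1 g2 hrec htan, fun q => ?_, fun hirr => ?_⟩
  · rw [isRecordMin_gammaSeq_iff hc.ne' hg g1 g2 hrec htan, exists_isBestApprox_iff]
    simp only [IsRecordMin, hlt]
  · have hg0 : g 0 = 0 := by simp [g, pencilSn_zero h0 h1]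
    have hgpos : ∀ n, 1 ≤ n → 0 < g n := fun n hn => by
      -- Comparison with index `0` turns positivity into `nθ` not being an integer.
      rw [← hg0, hlt]
      simpa [distNearestInt] using distNearestInt_pos_of_irrational hirr hn
    have hγ : ∀ n, 1 ≤ n → gammaSeq c r n = g n := fun n hn =>
      gammaSeq_eq_of_ne_zero g1 g2 hrec n hn fun j hj _ => (hgpos j hj).ne'
    have hpos : ∀ n, 1 ≤ n → 0 < gammaSeq c r n := fun n hn => (hγ n hn).symm ▸ hgpos n hn
    refine ⟨hpos, exists_strictMono_isRecordMin hpos fun ε hε => ?_⟩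
    have hcont : Tendsto (fun x => pencilSn k (x * (2 * P))) (𝓝 0) (𝓝 0) := by
      have h : ContinuousAt (pencilSn k) (0 * (2 * P)) :=
        (pencilSn_hasDerivAt h0 h1 _).continuousAt
      have h' : ContinuousAt (fun x : ℝ => pencilSn k (x * (2 * P))) 0 :=
        ContinuousAt.comp (f := fun x : ℝ => x * (2 * P)) h (by fun_prop)
      simpa [ContinuousAt, pencilSn_zero h0 h1] using h'
    -- Small values of `g` come from continuity of sn at `0` and Dirichlet's theorem.
    obtain ⟨δ, hδ, hball⟩ := Metric.tendsto_nhds_nhds.1 hcont (ε * s) (by positivity)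
    obtain ⟨n, hn, hnδ⟩ := exists_distNearestInt_lt θ hδ
    refine ⟨n, hn, ?_⟩
    rw [hγ n hn]
    simp only [g]
    rw [div_lt_iff₀ hs, hv, ← mul_assoc, abs_pencilSn_eq h0 h1]
    have h := hball (x := distNearestInt (n * θ))
      (by rwa [Real.dist_0_eq_abs, abs_of_nonneg (distNearestInt_nonneg _)])
    rw [Real.dist_0_eq_abs] at h
    exact (le_abs_self _).trans_lt h
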